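/- Let $V$ be a finite set with $|V| \ge 4$. All directed graphs $\mathcal{G} = (V,E)$ are taken to contain every self-loop $i \to i$, and such a graph is called a DAG if it has no directed cycle of length greater than one (self-loops are ignored). Write $\mathbb{R}^E$ for the set of real $V \times V$ matrices $M = (m_{ij})$ with $m_{ji} = 0$ whenever $i \to j \notin E$, and call $M$ stable if all its complex eigenvalues have strictly negative real part. The Lyapunov model of $\mathcal{G}$ (with uncorrelated noise, volatility matrix $C = 2I$) is $$\mathcal{M}_{\mathcal{G}} = \{\Sigma \text{ positive definite} : M\Sigma + \Sigma M^T + 2I = 0 \text{ for some stable } M \in \mathbb{R}^E\}.$$ Two graphs on the same vertex set are model equivalent if their Lyapunov models are equal. The skeleton of $\mathcal{G}$ is the undirected simple graph on $V$ in which distinct $i,j$ are adjacent iff $i \to j \in E$ or $j \to i \in E$. For $K \subseteq V$, $\mathcal{G}[K]$ denotes the induced subgraph with vertex set $K$. Theorem. Let $\mathcal{G}_1$ and $\mathcal{G}_2$ be DAGs on the vertex set $V$, $|V| \ge 4$. Then $\mathcal{G}_1$ and $\mathcal{G}_2$ are model equivalent if and only if they have the same skeleton and the induced subgraphs $\mathcal{G}_1[K]$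 and $\mathcal{G}_2[K]$ are model equivalent for all $K \subseteq V$ with $|K| = 4$. -/

import Mathlib

/-! Graphs are Mathlib's `Digraph`s; `G.Adj i j` means that `i → j` is an edge. -/

namespace Lyapunov

/-- A directed acyclic graph in the convention of Lyapunov models: every self-loop is an edge,
and, self-loops being ignored, there is no directed cycle. -/
structure IsDAG {V : Type*} (G : Digraph V) : Prop where
  loop : ∀ v, G.Adj v v
  acyclic : ∀ v, ¬ Relation.TransGen (fun i j => i ≠ j ∧ G.Adj i j) v v

/-- The skeleton: `i` and `j` are adjacent iff `i ≠ j` and `i → j` or `j → i` is an edge. -/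
abbrev skeleton {V : Type*} (G : Digraph V) : SimpleGraph V :=
  G.toSimpleGraphInclusive

/-- The induced subgraph `G[K]`, with vertex set `K`. -/
def induce {V : Type*} (G : Digraph V) (K : Finset V) : Digraph K where
  Adj i j := G.Adj i j

/-- The space `ℝ^E` of matrices `M` with `M j i = 0` whenever `i → j` is not an edge. -/
def sparse {V : Type*} (G : Digraph V) : Set (Matrix V V ℝ) :=
  {M | ∀ i j, ¬ G.Adj i j → M j i = 0}

/-- A real matrix is stable if all its complex eigenvalues have negative real part. -/
def IsStable {V : Type*} [Fintype V] [DecidableEq V] (M : Matrix V V ℝ) : Prop :=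
  ∀ z ∈ spectrum ℂ (M.map Complex.ofReal), z.re < 0

/-- The graphical continuous Lyapunov model of `G` with volatility matrix `C`,
as a set of covariance matrices. -/
def modelWith {V : Type*} [Fintype V] [DecidableEq V] (G : Digraph V) (C : Matrix V V ℝ) :
    Set (Matrix V V ℝ) :=
  {S | S.PosDef ∧ ∃ M ∈ sparse G, IsStable M ∧ M * S + S * M.transpose + C = 0}

/-- The Lyapunov model of `G` with volatility matrix `C = 2 I`. -/
def model {V : Type*} [Fintype V] [DecidableEq V] (G : Digraph V) : Set (Matrix V V ℝ) :=
  modelWith G ((2 : ℝ) • (1 : Matrix V V ℝ))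

/-- Model equivalence of two graphs on the same vertex set. -/
def ModelEquiv {V : Type*} [Fintype V] [DecidableEq V] (G₁ G₂ : Digraph V) : Prop :=
  model G₁ = model G₂

end Lyapunov

/-! A positive definite solution of the Lyapunov equation forces stability, so for fixed `S`
membership in a model is solvability of a linear system in `M`, and any two solutions differ by some
`D` with `D * S` skew.

Necessity is restriction: extending `S` by an identity block embeds the model of an induced subgraph
in that of the whole graph (`model_pull_subset`), and the two-vertex case detects the skeleton.

For sufficiency, `Compatible` is an intermediate combinatorial condition on the edges reversed
between the graphs. Each clause involves at most four vertices. If one fails, explicit covariance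
matrices on three or four vertices separate the models (`LocallyEquiv.compatible`). Conversely,
compatible graphs are joined by single-edge reversals that preserve acyclicity, compatibility and
the model (`Compatible.modelEquiv`). A reversal is realised by a rank-two skew correction that
cancels the coefficient of the reversed edge; `covariance_eq_zero` keeps its support within the
allowed edges (`model_subset_of_flip`). -/

namespace Lyapunov

open Matrix

/-! ### Stability and acyclicity -/

section Stability

variable {V : Type*} [Fintype V]

/-- The quadratic form of `M S + S Mᵀ` for symmetric `S`. -/
lemma dotProduct_lyapunov_mulVec {S M : Matrix V V ℝ} (hS : Sᵀ = S) (x : V → ℝ) :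
    x ⬝ᵥ ((M * S + S * Mᵀ) *ᵥ x) = 2 * ((x ᵥ* M) ⬝ᵥ (S *ᵥ x)) := by
  have h : x ⬝ᵥ ((S * Mᵀ) *ᵥ x) = (x ᵥ* M) ⬝ᵥ (S *ᵥ x) := by
    rw [← mulVec_mulVec, mulVec_transpose, dotProduct_mulVec, ← mulVec_transpose, hS,
      dotProduct_comm]
  rw [add_mulVec, dotProduct_add, h, ← mulVec_mulVec, dotProduct_mulVec]
  ring

/-- `r` strictly increases along the non-loop edges of `G`. -/
def IsRank {V : Type*} (G : Digraph V) (r : V → ℕ) : Prop :=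
  ∀ a b, G.Adj a b → a ≠ b → r a < r b

/-- The number of strict ancestors is a rank; acyclicity enters the later arguments through such
ranks. -/
lemma IsDAG.exists_isRank {G : Digraph V} (hG : IsDAG G) : ∃ r, IsRank G r := by
  classical
  refine ⟨fun v => (Finset.univ.filter
    fun u => Relation.TransGen (fun i j => i ≠ j ∧ G.Adj i j) u v).card, fun a b hab hne => ?_⟩
  refine Finset.card_lt_card (Finset.ssubset_iff_of_subset ?_ |>.2 ⟨a, ?_, ?_⟩)
  · intro u hu
    simp only [Finset.mem_filter, Finset.mem_univ, true_and] at hu ⊢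
    exact hu.tail ⟨hne, hab⟩
  · simpa using Relation.TransGen.single ⟨hne, hab⟩
  · simpa using hG.acyclic a

variable [DecidableEq V]

/-- A matrix solving the Lyapunov equation with a positive definite `S` is stable. -/
lemma isStable_of_lyapunov {S M : Matrix V V ℝ} (hS : S.PosDef)
    (h : M * S + S * Mᵀ + (2 : ℝ) • (1 : Matrix V V ℝ) = 0) : IsStable M := by
  intro z hz
  have hST : Sᵀ = S := by simpa using hS.isHermitian.eq
  have hdet : (algebraMap ℂ (Matrix V V ℂ) z - M.map Complex.ofReal).det = 0 := by
    by_contra hne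
    exact hz ((isUnit_iff_isUnit_det _).2 (isUnit_iff_ne_zero.2 hne))
  obtain ⟨v, hv0, hv⟩ := exists_vecMul_eq_zero_iff.2 hdet
  have hvz : v ᵥ* M.map Complex.ofReal = z • v := by
    rw [vecMul_sub, sub_eq_zero] at hv
    rw [← hv, Algebra.algebraMap_eq_smul_one, vecMul_smul, vecMul_one]
  set x : V → ℝ := fun k => (v k).re with hx
  set y : V → ℝ := fun k => (v k).im with hy
  have hxM : x ᵥ* M = z.re • x - z.im • y := by
    ext j
    have := congrArg Complex.re (congrFun hvz j)
    simpa [vecMul, dotProduct, hx, hy] using this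
  have hyM : y ᵥ* M = z.re • y + z.im • x := by
    ext j
    have := congrArg Complex.im (congrFun hvz j)
    simpa [vecMul, dotProduct, hx, hy] using this
  have hL : M * S + S * Mᵀ = -((2 : ℝ) • (1 : Matrix V V ℝ)) := eq_neg_of_add_eq_zero_left h
  -- Adding the two identities cancels the `z.im` terms by symmetry of `S`, leaving Re z · (xᵀSx +
  -- yᵀSy) = −(|x|² + |y|²).
  have qx := dotProduct_lyapunov_mulVec (M := M) hST x
  have qy := dotProduct_lyapunov_mulVec (M := M) hST y
  have hxy : y ⬝ᵥ (S *ᵥ x) = x ⬝ᵥ (S *ᵥ y) := by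
    rw [dotProduct_mulVec, ← mulVec_transpose, hST, dotProduct_comm]
  rw [hL, hxM] at qx
  rw [hL, hyM] at qy
  simp only [neg_mulVec, smul_mulVec, one_mulVec, dotProduct_neg, dotProduct_smul, smul_eq_mul,
    sub_dotProduct, add_dotProduct, smul_dotProduct] at qx qy
  have nx : 0 ≤ x ⬝ᵥ (S *ᵥ x) := by simpa using hS.posSemidef.dotProduct_mulVec_nonneg x
  have ny : 0 ≤ y ⬝ᵥ (S *ᵥ y) := by simpa using hS.posSemidef.dotProduct_mulVec_nonneg y
  have hpos : 0 < x ⬝ᵥ x + y ⬝ᵥ y := by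
    have h0 : 0 ≤ x ⬝ᵥ x := by simpa using dotProduct_star_self_nonneg x
    have h1 : 0 ≤ y ⬝ᵥ y := by simpa using dotProduct_star_self_nonneg y
    refine lt_of_le_of_ne (add_nonneg h0 h1) fun hc => hv0 ?_
    have hx0 : x = 0 := dotProduct_self_eq_zero.1 (by linarith)
    have hy0 : y = 0 := dotProduct_self_eq_zero.1 (by linarith)
    ext k
    exact Complex.ext (congrFun hx0 k) (congrFun hy0 k)
  by_contra hre
  have h3 := mul_nonneg (not_lt.1 hre) (add_nonneg nx ny)
  rw [hxy] at qx
  linarith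

lemma mem_model_iff {G : Digraph V} {S : Matrix V V ℝ} :
    S ∈ model G ↔ S.PosDef ∧ ∃ M ∈ sparse G,
      M * S + S * Mᵀ + (2 : ℝ) • (1 : Matrix V V ℝ) = 0 :=
  ⟨fun ⟨h, M, h1, _, h2⟩ => ⟨h, M, h1, h2⟩,
    fun ⟨h, M, h1, h2⟩ => ⟨h, M, h1, isStable_of_lyapunov h h2, h2⟩⟩

/-- The diagonal of a stable matrix supported on an acyclic graph is negative. -/
lemma diag_neg_of_isStable {G : Digraph V} {r : V → ℕ} (hr : IsRank G r)
    {M : Matrix V V ℝ} (hM : M ∈ sparse G) (hst : IsStable M) (i : V) : M i i < 0 := by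
  have key : ∀ a b, r a ≤ r b → a ≠ b → M a b = 0 := fun a b hab hne =>
    hM b a fun h => absurd (hr b a h hne.symm) (not_lt.2 hab)
  suffices h : ((M i i : ℝ) : ℂ) ∈ spectrum ℂ (M.map Complex.ofReal) by simpa using hst _ h
  intro hu
  have hdet := (isUnit_iff_isUnit_det _).1 hu
  set A := algebraMap ℂ (Matrix V V ℂ) (M i i : ℂ) - M.map Complex.ofReal with hA
  have hoff : ∀ a b, r a ≤ r b → a ≠ b → A a b = 0 := fun a b hab hne => by
    simp [hA, algebraMap_matrix_apply, hne, key a b hab hne]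
  -- Ranks may coincide, so triangularity is only blockwise; within the block of rank `r i` the row
  -- of `i` vanishes, making `A` singular.
  have hT : BlockTriangular Aᵀ r := fun a b hab => by
    rw [transpose_apply]
    exact hoff b a hab.le fun h => by simp [h] at hab
  rw [← det_transpose, hT.det] at hdet
  refine hdet.ne_zero (Finset.prod_eq_zero (Finset.mem_image_of_mem r (Finset.mem_univ i)) ?_)
  refine det_eq_zero_of_row_eq_zero ⟨i, rfl⟩ fun b => ?_
  by_cases hb : b.1 = i
  · simp [toSquareBlock_def, hb, hA, algebraMap_matrix_apply]
  · exact hoff b.1 i b.2.le hb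

end Stability

/-! ### Restriction to induced subgraphs -/

section Pullback

variable {V W : Type*} [Fintype V] [DecidableEq V] [Fintype W] [DecidableEq W]

/-- The pullback of a digraph along a map of vertex sets. -/
def pull {V W : Type*} (G : Digraph V) (f : W → V) : Digraph W where
  Adj a b := G.Adj (f a) (f b)

/-- Pulling back along an injection preserves model equivalence. -/
lemma model_pull_subset {G₁ G₂ : Digraph V} (hl : ∀ v, G₁.Adj v v) {f : W → V}
    (hf : Function.Injective f) (h : model G₁ ⊆ model G₂) :
    model (pull G₁ f) ⊆ model (pull G₂ f) := by
  intro S hS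
  obtain ⟨hS, M, hM, hL⟩ := mem_model_iff.1 hS
  set F : Matrix V W ℝ := (1 : Matrix V V ℝ).submatrix id f with hF
  have hFF : Fᵀ * F = 1 := by
    ext a b
    simp [hF, mul_apply, one_apply, hf.eq_iff]
  set P : Matrix V V ℝ := F * Fᵀ with hP
  have hPF : P * F = F := by rw [hP, Matrix.mul_assoc, hFF, Matrix.mul_one]
  have hFP : Fᵀ * P = Fᵀ := by rw [hP, ← Matrix.mul_assoc, hFF, Matrix.one_mul]
  have hPT : Pᵀ = P := by simp [hP]
  have hPP : P * P = P := by
    conv_lhs => rw [hP, Matrix.mul_assoc, hFP]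
  have hST : Sᵀ = S := by simpa using hS.isHermitian.eq
  -- Along the range of `f` and its complement, `T` is the block sum S ⊕ I.
  set T : Matrix V V ℝ := F * S * Fᵀ + (1 - P) with hT
  have hTF : T * F = F * S := by
    rw [hT, Matrix.add_mul, Matrix.sub_mul, Matrix.one_mul, hPF, sub_self, add_zero,
      Matrix.mul_assoc, hFF, Matrix.mul_one]
  have hFT : Fᵀ * T = S * Fᵀ := by
    rw [hT, Matrix.mul_add, Matrix.mul_sub, Matrix.mul_one, hFP, sub_self, add_zero,
      ← Matrix.mul_assoc, ← Matrix.mul_assoc, hFF, Matrix.one_mul]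
  have hPT' : (1 - P) * T = 1 - P := by
    have : P * T = F * S * Fᵀ := by rw [hP, Matrix.mul_assoc, hFT, Matrix.mul_assoc]
    rw [Matrix.sub_mul, Matrix.one_mul, this, hT]
    abel
  have hTP : T * (1 - P) = 1 - P := by
    have : T * P = F * S * Fᵀ := by rw [hP, ← Matrix.mul_assoc, hTF]
    rw [Matrix.mul_sub, Matrix.mul_one, this, hT]
    abel
  have hTpos : T.PosDef := by
    refine PosDef.of_dotProduct_mulVec_pos ?_ fun x hx => ?_
    · simp [hT, IsHermitian, hPT, hST, Matrix.mul_assoc]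
    have e1 : x ⬝ᵥ (T *ᵥ x) = (Fᵀ *ᵥ x) ⬝ᵥ (S *ᵥ (Fᵀ *ᵥ x))
        + ((1 - P) *ᵥ x) ⬝ᵥ ((1 - P) *ᵥ x) := by
      have e2 : (1 - P)ᵀ * (1 - P) = 1 - P := by
        rw [transpose_sub, transpose_one, hPT, Matrix.sub_mul, Matrix.one_mul, Matrix.mul_sub,
          Matrix.mul_one, hPP]
        abel
      rw [hT, add_mulVec, dotProduct_add]
      congr 1
      · rw [← mulVec_mulVec, ← mulVec_mulVec, dotProduct_mulVec, ← mulVec_transpose]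
      · conv_lhs => rw [← e2]
        rw [← mulVec_mulVec, dotProduct_mulVec, vecMul_transpose]
    rw [star_trivial, e1]
    have n2 : 0 ≤ ((1 - P) *ᵥ x) ⬝ᵥ ((1 - P) *ᵥ x) := by
      simpa using dotProduct_star_self_nonneg ((1 - P) *ᵥ x)
    by_cases h0 : Fᵀ *ᵥ x = 0
    · have : (1 - P) *ᵥ x = x := by
        rw [sub_mulVec, one_mulVec, hP, ← mulVec_mulVec, h0, mulVec_zero, sub_zero]
      rw [h0, this, zero_dotProduct, zero_add]
      rw [this] at n2
      exact lt_of_le_of_ne n2 fun h => hx (dotProduct_self_eq_zero.1 h.symm)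
    · have : 0 < (Fᵀ *ᵥ x) ⬝ᵥ (S *ᵥ (Fᵀ *ᵥ x)) := by simpa using hS.dotProduct_mulVec_pos h0
      linarith
  have hmem : T ∈ model G₁ := by
    -- The drift is M ⊕ (−I); its added diagonal entries are allowed by the self-loops.
    refine mem_model_iff.2 ⟨hTpos, F * M * Fᵀ - (1 - P), fun a b hab => ?_, ?_⟩
    · have hne : b ≠ a := fun h => hab (h ▸ hl a)
      have z1 : (F * M * Fᵀ) b a = 0 := by
        simp only [mul_apply, hF, submatrix_apply, transpose_apply, one_apply, id,
          Finset.sum_mul]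
        refine Finset.sum_eq_zero fun c _ => Finset.sum_eq_zero fun d _ => ?_
        split_ifs with u w
        · rw [hM c d fun h => hab (by subst u w; exact h)]
          simp
        all_goals simp
      have z2 : P b a = 0 := by
        simp only [hP, mul_apply, hF, submatrix_apply, transpose_apply, one_apply, id]
        refine Finset.sum_eq_zero fun c _ => ?_
        split_ifs with u w
        · exact absurd (u.trans w.symm) hne
        all_goals simp
      simp [z1, z2, hne]
    · have t1 : (F * M * Fᵀ - (1 - P)) * T = F * (M * S) * Fᵀ - (1 - P) := by
        rw [Matrix.sub_mul, hPT', Matrix.mul_assoc, hFT]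
        simp only [Matrix.mul_assoc]
      have t2 : T * (F * M * Fᵀ - (1 - P))ᵀ = F * (S * Mᵀ) * Fᵀ - (1 - P) := by
        have hQ : (1 - P)ᵀ = 1 - P := by rw [transpose_sub, transpose_one, hPT]
        rw [transpose_sub, hQ, Matrix.mul_sub, hTP, transpose_mul, transpose_mul,
          transpose_transpose, ← Matrix.mul_assoc, hTF]
        simp only [Matrix.mul_assoc]
      have t3 : M * S + S * Mᵀ = -((2 : ℝ) • (1 : Matrix W W ℝ)) := eq_neg_of_add_eq_zero_left hL
      have t4 : F * (M * S) * Fᵀ + F * (S * Mᵀ) * Fᵀ = -((2 : ℝ) • P) := by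
        rw [← Matrix.add_mul, ← Matrix.mul_add, t3]
        simp [hP]
      rw [t1, t2, sub_add_sub_comm, t4]
      module
  obtain ⟨-, M', hM', hL'⟩ := mem_model_iff.1 (h hmem)
  -- `T` has no cross block, so compressing the equation involves only the principal block of `M'`.
  refine mem_model_iff.2 ⟨hS, M'.submatrix f f, fun a b hab => hM' _ _ hab, ?_⟩
  have hsub : M'.submatrix f f = Fᵀ * M' * F := by
    ext a b
    simp [hF, mul_apply, one_apply]
  have := congrArg (fun X => Fᵀ * X * F) hL'
  simp only [Matrix.mul_add, Matrix.add_mul, Matrix.mul_zero, Matrix.zero_mul, Matrix.mul_smul,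
    Matrix.smul_mul, Matrix.mul_one, hFF] at this
  rw [← this, hsub]
  congr 2
  · simp only [Matrix.mul_assoc, hTF]
  · rw [← Matrix.mul_assoc Fᵀ, hFT]
    simp only [transpose_mul, transpose_transpose, Matrix.mul_assoc]

lemma ModelEquiv.pull {G₁ G₂ : Digraph V} (h₁ : ∀ v, G₁.Adj v v) (h₂ : ∀ v, G₂.Adj v v)
    {f : W → V} (hf : Function.Injective f) (h : ModelEquiv G₁ G₂) :
    ModelEquiv (pull G₁ f) (pull G₂ f) :=
  (model_pull_subset h₁ hf h.le).antisymm (model_pull_subset h₂ hf h.ge)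

end Pullback

end Lyapunov

namespace Lyapunov

open Matrix

/-! ### Reversing one edge by a skew correction -/

section Flip

variable {V : Type*} [Fintype V] [DecidableEq V]

/-- The columns of the inverse of a principal submatrix, extended by zero. -/
lemma exists_principal_inverse_column {S : Matrix V V ℝ} (hS : S.PosDef) (A : Set V) {i : V}
    (hi : i ∈ A) :
    ∃ x : V → ℝ, (∀ v, v ∉ A → x v = 0) ∧ (∀ s ∈ A, (S *ᵥ x) s = if s = i then 1 else 0) ∧
      x i ≠ 0 := by
  classical
  set B : Matrix A A ℝ := S.submatrix Subtype.val Subtype.val with hB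
  have hBp : B.PosDef := hS.submatrix Subtype.val_injective
  set y : A → ℝ := fun a => B⁻¹ a ⟨i, hi⟩ with hy
  refine ⟨fun v => if h : v ∈ A then y ⟨v, h⟩ else 0, fun v hv => by simp [hv], fun s hs => ?_, ?_⟩
  · have h1 : (B * B⁻¹) ⟨s, hs⟩ ⟨i, hi⟩ = if s = i then 1 else 0 := by
      rw [mul_nonsing_inv _ ((isUnit_iff_isUnit_det _).1 hBp.isUnit), one_apply]
      simp
    rw [← h1]
    simp only [mulVec, dotProduct, mul_apply]
    refine Finset.sum_congr_set A _ _ (fun v hv => ?_) fun v hv => ?_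
    · simp [hv, hB, hy]
    · simp [hv]
  · simpa [hi, hy] using ne_of_gt (hBp.inv.diag_pos (i := ⟨i, hi⟩))

/-- If no edge enters `A` from outside and no edge leaves `A ∪ B`, the covariances between `A` and
the complement of `A ∪ B` vanish. -/
lemma covariance_eq_zero {G : Digraph V} {r : V → ℕ} (hr : IsRank G r) {S M : Matrix V V ℝ}
    (hM : M ∈ sparse G) (hst : IsStable M)
    (hL : M * S + S * Mᵀ + (2 : ℝ) • (1 : Matrix V V ℝ) = 0) {A B : Set V}
    (hA : ∀ a s, G.Adj a s → s ∈ A → a ∈ A)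
    (hB : ∀ a b, G.Adj a b → a ∈ A ∪ B → b ∈ A ∪ B) {w s : V} (hw : w ∉ A ∪ B) (hs : s ∈ A) :
    S w s = 0 := by
  induction hn : r w + r s using Nat.strong_induction_on generalizing w s with
  | _ n ih =>
  have hws : w ≠ s := fun h => hw (Or.inl (h ▸ hs))
  -- Parents of `s` lie in `A` and parents of `w` lie outside `A ∪ B`, so induction kills every term
  -- except `(M w w + M s s) * S w s`, whose first factor is negative.
  have e := congrFun (congrFun hL w) s
  simp only [Matrix.add_apply, mul_apply, transpose_apply, Matrix.smul_apply, one_apply_ne hws,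
    smul_zero,
    add_zero, Matrix.zero_apply] at e
  rw [Finset.sum_eq_single_of_mem w (Finset.mem_univ w), Finset.sum_eq_single_of_mem s
    (Finset.mem_univ s)] at e
  · have h1 := diag_neg_of_isStable hr hM hst w
    have h2 := diag_neg_of_isStable hr hM hst s
    have h3 : (M w w + M s s) * S w s = 0 := by linarith
    exact (mul_eq_zero.1 h3).resolve_left (by linarith)
  · intro a _ hne
    by_cases has : G.Adj a s
    · rw [ih _ (hn ▸ Nat.add_lt_add_left (hr _ _ has hne) _) hw (hA _ _ has hs) rfl, zero_mul]
    · rw [hM _ _ has, mul_zero]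
  · intro a _ hne
    by_cases haw : G.Adj a w
    · rw [ih _ (hn ▸ Nat.add_lt_add_right (hr _ _ haw hne) _)
        (fun h => hw (hB _ _ haw h)) hs rfl, mul_zero]
    · rw [hM _ _ haw, zero_mul]

/-- The edge `i → j` may be traded for `j → i`, provided that the set `A` containing `i` and `j` is
ancestral, consists of common parents of `i` and `j` otherwise, and every descendant of `A` outside
of `A` is a child of all of `A`. -/
lemma model_subset_of_flip {G G' : Digraph V} {r : V → ℕ} (hr : IsRank G r) {A B : Set V}
    {i j : V} (hi : i ∈ A) (hj : j ∈ A) (hij : i ≠ j)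
    (hA : ∀ a s, G.Adj a s → s ∈ A → a ∈ A)
    (hB : ∀ a b, G.Adj a b → a ∈ A ∪ B → b ∈ A ∪ B)
    (hsub : ∀ a b, G.Adj a b → ¬ (a = i ∧ b = j) → G'.Adj a b)
    (hpi : ∀ s ∈ A, G'.Adj s i) (hpj : ∀ s ∈ A, s ≠ i → G'.Adj s j)
    (hAB : ∀ s ∈ A, ∀ k ∈ B, G'.Adj s k) :
    model G ⊆ model G' := by
  rintro S ⟨hS, M, hM, hst, hL⟩
  have hL : M * S + S * Mᵀ + (2 : ℝ) • (1 : Matrix V V ℝ) = 0 := hL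
  have hST : Sᵀ = S := by simpa using hS.isHermitian.eq
  obtain ⟨x, hx0, hx, hxi⟩ := exists_principal_inverse_column hS A hi
  obtain ⟨y, hy0, hy, -⟩ := exists_principal_inverse_column hS A hj
  have hz : ∀ u : V → ℝ, (∀ v, v ∉ A → u v = 0) → ∀ w, w ∉ A ∪ B → (S *ᵥ u) w = 0 := by
    intro u hu w hw
    refine Finset.sum_eq_zero fun v _ => ?_
    change S w v * u v = 0
    by_cases hv : v ∈ A
    · rw [covariance_eq_zero hr hM hst hL hA hB hw hv, zero_mul]
    · rw [hu v hv, mul_zero]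
  -- `D * S` is skew for any `b`. On rows in `A`, `S *ᵥ x` and `S *ᵥ y` are unit vectors at `i` and
  -- `j`, so the entry `D j i` is `-b * x i`; this `b` makes it cancel `M j i`. Otherwise `D` has
  -- columns in `A` and rows in `{i, j} ∪ B`.
  set b : ℝ := M j i / x i with hb
  set D : Matrix V V ℝ := b • (vecMulVec (S *ᵥ x) y - vecMulVec (S *ᵥ y) x) with hD
  have hDS : D * S = b • (vecMulVec (S *ᵥ x) (S *ᵥ y) - vecMulVec (S *ᵥ y) (S *ᵥ x)) := by
    rw [hD, Matrix.smul_mul, Matrix.sub_mul, vecMulVec_mul, vecMulVec_mul, ← mulVec_transpose,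
      ← mulVec_transpose, hST]
  have hSD : S * Dᵀ = -(D * S) := by
    have : S * Dᵀ = (D * S)ᵀ := by rw [transpose_mul, hST]
    rw [this, hDS]
    ext a c
    simp [vecMulVec_apply]
    ring
  refine mem_model_iff.2 ⟨hS, M + D, fun a c hac => ?_, ?_⟩
  · have hDe : D c a = b * ((S *ᵥ x) c * y a - (S *ᵥ y) c * x a) := by
      simp [hD, vecMulVec_apply]
    rw [Matrix.add_apply, hDe]
    by_cases hac' : a = i ∧ c = j
    · obtain ⟨rfl, rfl⟩ := hac'
      rw [hx _ hj, hy _ hj, if_neg hij.symm, if_pos rfl, hb]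
      field_simp
      ring
    rw [hM a c fun h => hac (hsub a c h hac'), zero_add]
    by_cases ha : a ∈ A
    swap
    · rw [hx0 a ha, hy0 a ha]
      ring
    by_cases hc : c ∈ A
    · have hci : c ≠ i := fun h => hac (h ▸ hpi a ha)
      have hcj : c ≠ j := fun h => hac' ⟨by
        by_contra hne
        exact hac (h ▸ hpj a ha hne), h⟩
      rw [hx c hc, hy c hc, if_neg hci, if_neg hcj]
      ring
    · have hcB : c ∉ A ∪ B := fun h => h.elim hc fun h => hac (hAB a ha c h)
      rw [hz x hx0 c hcB, hz y hy0 c hcB]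
      ring
  · rw [transpose_add, Matrix.add_mul, Matrix.mul_add, hSD, ← hL]
    abel

end Flip

end Lyapunov

namespace Lyapunov

/-! ### Compatible graphs are joined by edge reversals -/

section Compatible

variable {V : Type*}

/-- Two vertices are linked if they are equal or joined by an edge, in a graph with all loops. -/
def Linked (G : Digraph V) (a b : V) : Prop :=
  G.Adj a b ∨ G.Adj b a

lemma Linked.symm {G : Digraph V} {a b : V} (h : Linked G a b) : Linked G b a :=
  Or.symm h

/-- The combinatorial form of model equivalence: same skeleton, and around each edge `i → j` of `G₁`
that is reversed in `G₂` the neighbourhood of `i` and `j` is as complete as a reversal needs. -/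
structure Compatible (G₁ G₂ : Digraph V) : Prop where
  link : ∀ a b, Linked G₁ a b ↔ Linked G₂ a b
  twin : ∀ i j, i ≠ j → G₁.Adj i j → G₂.Adj j i → ∀ p, Linked G₁ p i ↔ Linked G₁ p j
  parent : ∀ i j, i ≠ j → G₁.Adj i j → G₂.Adj j i →
    ∀ p q, G₁.Adj p i → Linked G₁ p q → Linked G₁ q i
  child : ∀ i j, i ≠ j → G₁.Adj i j → G₂.Adj j i →
    ∀ k l, G₁.Adj i k → G₁.Adj k l → Linked G₁ l i
  through : ∀ i j, i ≠ j → G₁.Adj i j → G₂.Adj j i →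
    ∀ p k, G₁.Adj p i → G₁.Adj i k → Linked G₁ p k

/-- The graph `G` with the edge `i → j` replaced by `j → i`. -/
def flip (G : Digraph V) (i j : V) : Digraph V where
  Adj a b := (G.Adj a b ∧ ¬ (a = i ∧ b = j)) ∨ (a = j ∧ b = i)

lemma flip_adj {G : Digraph V} {i j a b : V} :
    (flip G i j).Adj a b ↔ (G.Adj a b ∧ ¬ (a = i ∧ b = j)) ∨ (a = j ∧ b = i) :=
  Iff.rfl

lemma linked_flip {G : Digraph V} {i j : V} (hij : i ≠ j) (h : G.Adj i j) (a b : V) :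
    Linked (flip G i j) a b ↔ Linked G a b := by
  unfold Linked
  simp only [flip_adj]
  by_cases h1 : a = i ∧ b = j
  · obtain ⟨rfl, rfl⟩ := h1
    simp [h]
  by_cases h2 : a = j ∧ b = i
  · obtain ⟨rfl, rfl⟩ := h2
    simp [h]
  · have h3 : ¬ (b = i ∧ a = j) := fun h => h2 h.symm
    have h4 : ¬ (b = j ∧ a = i) := fun h => h1 h.symm
    simp [h1, h2, h3, h4]

lemma IsRank.le {G : Digraph V} {r : V → ℕ} (hr : IsRank G r) {a b : V} (h : G.Adj a b) :
    r a ≤ r b := by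
  by_cases hab : a = b
  · rw [hab]
  · exact (hr a b h hab).le

/-- Reversed edges of the new graph were already reversed before, and linkage is unchanged. Only
clauses that use the new edge `j → i` need an argument, and there `twin` exchanges `i` and `j`. -/
lemma Compatible.flip {G₁ G₂ : Digraph V} {r : V → ℕ} (h : Compatible G₁ G₂) (hr : IsRank G₂ r)
    {i j : V} (hij : i ≠ j) (h1 : G₁.Adj i j) (h2 : G₂.Adj j i) :
    Compatible (flip G₁ i j) G₂ := by
  have hlink := linked_flip hij h1
  have htw := h.twin i j hij h1 h2
  have hold : ∀ a b, a ≠ b → (Lyapunov.flip G₁ i j).Adj a b → G₂.Adj b a → G₁.Adj a b := by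
    rintro a b hab (hh | ⟨rfl, rfl⟩) h'
    · exact hh.1
    · exact absurd ((hr _ _ h2 hab).trans (hr _ _ h' hab.symm)) (lt_irrefl _)
  refine ⟨fun a b => (hlink a b).trans (h.link a b), ?_, ?_, ?_, ?_⟩
  · intro a b hab ha hb p
    rw [hlink, hlink]
    exact h.twin a b hab (hold a b hab ha hb) hb p
  · intro a b hab ha hb p q hp hpq
    rw [hlink] at hpq ⊢
    rcases hp with hp | ⟨rfl, rfl⟩
    · exact h.parent a b hab (hold a b hab ha hb) hb p q hp.1 hpq
    · exact (htw q).2 hpq.symm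
  · intro a b hab ha hb k l hk hl
    rw [hlink]
    rcases hk with hk | ⟨rfl, rfl⟩
    · rcases hl with hl | ⟨rfl, rfl⟩
      · exact h.child a b hab (hold a b hab ha hb) hb k l hk.1 hl.1
      · exact ((htw a).2 (Or.inl hk.1)).symm
    · have : Linked G₁ k l := (hlink k l).1 (Or.inl hl)
      exact (htw l).1 this.symm
  · intro a b hab ha hb p k hp hk
    rw [hlink]
    rcases hp with hp | ⟨rfl, rfl⟩
    · rcases hk with hk | ⟨rfl, rfl⟩
      · exact h.through a b hab (hold a b hab ha hb) hb p k hp.1 hk.1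
      · exact (htw p).2 (Or.inl hp.1)
    · have : Linked G₁ a k := (hlink a k).1 (Or.inl hk)
      exact ((htw k).1 this.symm).symm

/-- A reversed edge can be chosen with no directed path of length two between its ends. -/
lemma exists_flipped_no_between {G₁ G₂ : Digraph V} (h : ∀ a b, Linked G₁ a b ↔ Linked G₂ a b)
    {r₁ r₂ : V → ℕ} (hr₁ : IsRank G₁ r₁) (hr₂ : IsRank G₂ r₂) {i j : V} (hij : i ≠ j)
    (h1 : G₁.Adj i j) (h2 : G₂.Adj j i) :
    ∃ i j, i ≠ j ∧ G₁.Adj i j ∧ G₂.Adj j i ∧ ∀ l, l ≠ i → l ≠ j → G₁.Adj i l → ¬ G₁.Adj l j := by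
  induction hn : r₁ j - r₁ i using Nat.strong_induction_on generalizing i j with
  | _ n ih =>
  by_cases hb : ∀ l, l ≠ i → l ≠ j → G₁.Adj i l → ¬ G₁.Adj l j
  · exact ⟨i, j, hij, h1, h2, hb⟩
  push Not at hb
  obtain ⟨l, hli, hlj, hil, hlj'⟩ := hb
  have r1 := hr₁ _ _ hil hli.symm
  have r2 := hr₁ _ _ hlj' hlj
  -- As `G₂` has `j → i` and no cycle, it reverses `i → l` or `l → j`, an edge with a smaller rank
  -- gap.
  rcases (h i l).1 (Or.inl hil) with e | e
  · rcases (h l j).1 (Or.inl hlj') with e' | e'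
    · have := hr₂ _ _ e hli.symm
      have := hr₂ _ _ e' hlj
      have := hr₂ _ _ h2 hij.symm
      omega
    · exact ih _ (by omega) hlj hlj' e' rfl
  · exact ih _ (by omega) hli.symm hil e rfl

variable [Fintype V] [DecidableEq V]

/-- With no path `i → l → j`, the ends share their other parents and their other children. Hence
exchanging the ranks of `i` and `j` ranks the new graph, and `model_subset_of_flip` applies with `A`
the parents of `i` together with `j`, and `B` the remaining children of `i`. -/
lemma Compatible.model_flip {G₁ G₂ : Digraph V} {r : V → ℕ} (h : Compatible G₁ G₂)
    (hl : ∀ v, G₁.Adj v v) (hr : IsRank G₁ r) {i j : V} (hij : i ≠ j) (h1 : G₁.Adj i j)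
    (h2 : G₂.Adj j i) (hno : ∀ l, l ≠ i → l ≠ j → G₁.Adj i l → ¬ G₁.Adj l j) :
    model G₁ = model (Lyapunov.flip G₁ i j) ∧
      IsRank (Lyapunov.flip G₁ i j) (r ∘ Equiv.swap i j) := by
  have htw := h.twin i j hij h1 h2
  have hrij := hr i j h1 hij
  have pj : ∀ p, G₁.Adj p j → p ≠ j → G₁.Adj p i := fun p hp hne => by
    rcases (htw p).2 (Or.inl hp) with e | e
    · exact e
    · by_cases hpi : p = i
      · exact hpi ▸ hl p
      · exact absurd hp (hno p hpi hne e)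
  have pi : ∀ p, G₁.Adj p i → G₁.Adj p j := fun p hp => by
    rcases (htw p).1 (Or.inl hp) with e | e
    · exact e
    · have := hr.le hp
      have := hr.le e
      omega
  have pp : ∀ q p, G₁.Adj q p → G₁.Adj p i → G₁.Adj q i := fun q p hq hp => by
    rcases h.parent i j hij h1 h2 p q hp (Or.inr hq) with e | e
    · exact e
    · have := hr.le hp
      have := hr.le hq
      by_cases hqi : q = i
      · exact hqi ▸ hl q
      · have := hr _ _ e (Ne.symm hqi)
        omega
  set A : Set V := {p | G₁.Adj p i ∨ p = j} with hA
  set B : Set V := {k | G₁.Adj i k ∧ k ≠ i ∧ k ≠ j} with hB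
  have hiA : i ∈ A := Or.inl (hl i)
  have hjA : j ∈ A := Or.inr rfl
  have anc : ∀ a s, G₁.Adj a s → s ∈ A → a ∈ A := by
    rintro a s has (hs | rfl)
    · exact Or.inl (pp a s has hs)
    · by_cases haj : a = s
      · exact Or.inr haj
      · exact Or.inl (pj a has haj)
  have linkB : ∀ k, Linked G₁ k i → k ∈ A ∪ B := fun k hk => by
    by_cases hkj : k = j
    · exact Or.inl (Or.inr hkj)
    by_cases hki : k = i
    · exact Or.inl (hki ▸ hiA)
    rcases hk with e | e
    · exact Or.inl (Or.inl e)
    · exact Or.inr ⟨e, hki, hkj⟩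
  have desc : ∀ a b, G₁.Adj a b → a ∈ A ∪ B → b ∈ A ∪ B := by
    rintro a b hab ((ha | rfl) | ha)
    · exact linkB b (h.parent i j hij h1 h2 a b ha (Or.inl hab))
    · exact linkB b ((htw b).2 (Or.inr hab))
    · exact linkB b (h.child i j hij h1 h2 a b ha.1 hab)
  have full : ∀ s ∈ A, ∀ k ∈ B, G₁.Adj s k := by
    rintro s (hs | rfl) k ⟨hk, hki, hkj⟩
    · rcases h.through i j hij h1 h2 s k hs hk with e | e
      · exact e
      · have := hr.le hs
        have := hr.le e
        have := hr _ _ hk hki.symm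
        omega
    · rcases (htw k).1 (Or.inr hk) with e | e
      · exact absurd e (hno k hki hkj hk)
      · exact e
  have hrank : IsRank (Lyapunov.flip G₁ i j) (r ∘ Equiv.swap i j) := by
    rintro a b (⟨hab, hn⟩ | ⟨rfl, rfl⟩) hne
    · have hr0 := hr a b hab hne
      simp only [Function.comp_apply, Equiv.swap_apply_def]
      by_cases hai : a = i
      · subst hai
        have hbj : b ≠ j := fun e => hn ⟨rfl, e⟩
        have := hr _ _ (full j hjA b ⟨hab, hne.symm, hbj⟩) hbj.symm
        simpa [hne.symm, hbj] using this
      by_cases haj : a = j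
      · subst haj
        have hbi : b ≠ i := fun e => by subst e; omega
        have : r i < r b := by omega
        simpa [hne.symm, hbi, hai] using this
      by_cases hbi : b = i
      · subst hbi
        have : r a < r j := by omega
        simpa [hai, haj] using this
      by_cases hbj : b = j
      · subst hbj
        have := hr _ _ (pj a hab haj) hai
        simpa [hai, haj, hbi] using this
      · simpa [hai, haj, hbi, hbj] using hr0
    · simpa using hrij
  refine ⟨Set.Subset.antisymm ?_ ?_, hrank⟩
  · refine model_subset_of_flip hr hiA hjA hij anc desc (fun a b hab hn => Or.inl ⟨hab, hn⟩)
      ?_ ?_ ?_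
    · rintro s (hs | rfl)
      · exact Or.inl ⟨hs, fun e => hij e.2⟩
      · exact Or.inr ⟨rfl, rfl⟩
    · rintro s (hs | rfl) hne
      · exact Or.inl ⟨pi s hs, fun e => hne e.1⟩
      · exact Or.inl ⟨hl s, fun e => hne e.1⟩
    · exact fun s hs k hk => Or.inl ⟨full s hs k hk, fun e => hk.2.2 e.2⟩
  -- The same `A` and `B` serve the reverse flip, with `i` and `j` exchanged.
  · refine model_subset_of_flip hrank (A := A) (B := B) hjA hiA hij.symm ?_ ?_ ?_ ?_ ?_ full
    · rintro a s (has | ⟨rfl, rfl⟩) hs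
      · exact anc a s has.1 hs
      · exact hjA
    · rintro a b (hab | ⟨rfl, rfl⟩) ha
      · exact desc a b hab.1 ha
      · exact Or.inl hiA
    · rintro a b (hab | hab) hn
      · exact hab.1
      · exact absurd hab hn
    · rintro s (hs | rfl)
      · exact pi s hs
      · exact hl s
    · rintro s (hs | rfl) hne
      · exact hs
      · exact absurd rfl hne

/-- Induction on the number of edges on which the graphs disagree. -/
lemma Compatible.modelEquiv {G₁ G₂ : Digraph V} {r₁ r₂ : V → ℕ} (h : Compatible G₁ G₂)
    (hl₁ : ∀ v, G₁.Adj v v) (hl₂ : ∀ v, G₂.Adj v v) (hr₁ : IsRank G₁ r₁) (hr₂ : IsRank G₂ r₂) :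
    ModelEquiv G₁ G₂ := by
  induction hn : {e : V × V | e.1 ≠ e.2 ∧ G₁.Adj e.1 e.2 ∧ G₂.Adj e.2 e.1}.ncard
    using Nat.strong_induction_on generalizing G₁ r₁ with
  | _ n ih =>
  by_cases hex : ∃ i j, i ≠ j ∧ G₁.Adj i j ∧ G₂.Adj j i
  · obtain ⟨i, j, hij, h1, h2⟩ := hex
    obtain ⟨i, j, hij, h1, h2, hno⟩ := exists_flipped_no_between h.link hr₁ hr₂ hij h1 h2
    obtain ⟨hm, hrank⟩ := h.model_flip hl₁ hr₁ hij h1 h2 hno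
    refine hm.trans (ih _ ?_ (h.flip hr₂ hij h1 h2)
      (fun v => Or.inl ⟨hl₁ v, fun e => hij (e.1.symm.trans e.2)⟩) hrank rfl)
    rw [← hn]
    refine Set.ncard_lt_ncard (Set.ssubset_iff_of_subset ?_ |>.2 ⟨(i, j), ⟨hij, h1, h2⟩, ?_⟩)
      (Set.toFinite _)
    · rintro ⟨a, b⟩ ⟨hab, ha | ⟨rfl, rfl⟩, hb⟩
      · exact ⟨hab, ha.1, hb⟩
      · exact absurd ((hr₂ _ _ h2 hab).trans (hr₂ _ _ hb hab.symm)) (lt_irrefl _)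
    · rintro ⟨-, ha | ha, -⟩
      · exact ha.2 ⟨rfl, rfl⟩
      · exact hij ha.1
  · push Not at hex
    have : G₁ = G₂ := by
      ext a b
      by_cases hab : a = b
      · subst hab
        exact iff_of_true (hl₁ a) (hl₂ a)
      · constructor
        · exact fun e => ((h.link a b).1 (Or.inl e)).resolve_right (hex a b hab e)
        · exact fun e => ((h.link a b).2 (Or.inl e)).resolve_right
            fun e' => hex b a (Ne.symm hab) e' e
    exact congrArg model this

end Compatible

end Lyapunov

namespace Lyapunov

open Matrix

/-! ### Separating covariance matrices on at most four vertices -/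

section Examples

variable {n : ℕ} {H : Digraph (Fin n)} {S : Matrix (Fin n) (Fin n) ℝ}

lemma lyapunov_iff_entries {M : Matrix (Fin n) (Fin n) ℝ} (hS : Sᵀ = S) :
    M * S + S * Mᵀ + (2 : ℝ) • (1 : Matrix (Fin n) (Fin n) ℝ) = 0 ↔
      ∀ i j, i ≤ j → ∑ k, (M i k * S k j + S i k * M j k) = if i = j then -2 else 0 := by
  have key : ∀ i j, (M * S + S * Mᵀ + (2 : ℝ) • (1 : Matrix (Fin n) (Fin n) ℝ)) i j = 0 ↔
      ∑ k, (M i k * S k j + S i k * M j k) = if i = j then -2 else 0 := by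
    intro i j
    rw [Matrix.add_apply, Matrix.add_apply, Matrix.mul_apply, Matrix.mul_apply,
      ← Finset.sum_add_distrib, Matrix.smul_apply, Matrix.one_apply]
    split_ifs
    · simp [transpose_apply, eq_neg_iff_add_eq_zero]
    · simp [transpose_apply]
  constructor
  · intro h i j _
    exact (key i j).1 (by rw [h]; rfl)
  · intro h
    ext i j
    rw [Matrix.zero_apply, key i j]
    rcases le_total i j with hij | hij
    · exact h i j hij
    · have hsw : ∑ k, (M i k * S k j + S i k * M j k) = ∑ k, (M j k * S k i + S j k * M i k) := by
        refine Finset.sum_congr rfl fun k _ => ?_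
        have e1 : S k j = S j k := congrFun (congrFun hS j) k
        have e2 : S i k = S k i := congrFun (congrFun hS k) i
        rw [e1, e2]
        ring
      rw [hsw, h j i hij]
      simp [eq_comm]

/-- Membership in a model, with positive definiteness certified by an `L D Lᵀ` decomposition. -/
lemma mem_model_of_entries (M L : Matrix (Fin n) (Fin n) ℝ) (d : Fin n → ℝ)
    (hL : ∀ i j, i < j → L i j = 0) (h1 : ∀ i, L i i = 1) (hd : ∀ i, 0 < d i)
    (hS : ∀ i j, ∑ k, L i k * d k * L j k = S i j) (hM : ∀ i j, ¬ H.Adj i j → M j i = 0)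
    (he : ∀ i j, i ≤ j → ∑ k, (M i k * S k j + S i k * M j k) = if i = j then -2 else 0) :
    S ∈ model H := by
  have hdet : L.det = 1 := by
    rw [det_of_isLowerTriangular L fun i j hij => hL i j hij]
    simp [h1]
  have hS' : L * diagonal d * Lᵀ = S := by
    ext i j
    rw [Matrix.mul_apply, ← hS]
    simp [mul_diagonal]
  have hp : S.PosDef := by
    rw [← hS']
    simpa using (PosDef.diagonal hd).mul_mul_conjTranspose_same (B := L)
      (vecMul_injective_of_isUnit ((isUnit_iff_isUnit_det L).2 (by simp [hdet])))
  exact mem_model_iff.2 ⟨hp, M, hM,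
    (lyapunov_iff_entries (by simpa using hp.isHermitian.eq)).2 he⟩

/-- For numerical `S` the equations are linear in `M`. In each example the missing edges leave fewer
unknowns than equations (2 against 3, 5 against 6, 8 or 9 against 10), and the chosen `S` makes the
system inconsistent. -/
lemma exists_entries_of_mem_model (h : S ∈ model H) :
    ∃ M : Matrix (Fin n) (Fin n) ℝ, (∀ i j, ¬ H.Adj i j → M j i = 0) ∧
      ∀ i j, i ≤ j → ∑ k, (M i k * S k j + S i k * M j k) = if i = j then -2 else 0 := by
  obtain ⟨hp, M, hM, e⟩ := mem_model_iff.1 h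
  exact ⟨M, hM, (lyapunov_iff_entries (by simpa using hp.isHermitian.eq)).1 e⟩

/-- A dependence between the ends of an edge. -/
lemma not_subset_of_edge {H₁ H₂ : Digraph (Fin 2)} (hl : ∀ v, H₁.Adj v v) (e01 : H₁.Adj 0 1)
    (n01 : ¬ H₂.Adj 0 1) (n10 : ¬ H₂.Adj 1 0) :
    ¬ model H₁ ⊆ model H₂ := by
  intro h
  have hS : !![1, 2; 2, 9] ∈ model H₁ := by
    refine mem_model_of_entries !![-1, 0; 4, -1]
      !![1, 0; 2, 1] ![1, 5]
      ?_ ?_ ?_ ?_ ?_ ?_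
    · simp [Fin.forall_fin_succ]
    · simp [Fin.forall_fin_succ]
    · simp [Fin.forall_fin_succ]
    · norm_num [Fin.forall_fin_succ, Fin.sum_univ_succ]
    · simp [Fin.forall_fin_succ, hl, e01]
    · norm_num [Fin.forall_fin_succ, Fin.sum_univ_succ]
  obtain ⟨M, hM, e⟩ := exists_entries_of_mem_model (h hS)
  simp [Fin.forall_fin_succ, Fin.sum_univ_succ, hM _ _ n01, hM _ _ n10] at e
  linarith

/-- A covariance matrix of the chain `0 → 1 → 2` that no path with `2 → 1` explains. -/
lemma not_subset_of_chain {H₁ H₂ : Digraph (Fin 3)} (hl : ∀ v, H₁.Adj v v) (e01 : H₁.Adj 0 1)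
    (e12 : H₁.Adj 1 2) (n12 : ¬ H₂.Adj 1 2) (n02 : ¬ H₂.Adj 0 2) (n20 : ¬ H₂.Adj 2 0)
    (n : ¬ H₂.Adj 0 1 ∨ ¬ H₂.Adj 1 0) :
    ¬ model H₁ ⊆ model H₂ := by
  intro h
  have hS : !![1, 1, 1; 1, 3, 4; 1, 4, 9] ∈ model H₁ := by
    refine mem_model_of_entries !![-1, 0, 0; 2, -1, 0; 0, 2, -1]
      !![1, 0, 0; 1, 1, 0; 1, 3/2, 1] ![1, 2, 7/2]
      ?_ ?_ ?_ ?_ ?_ ?_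
    · simp [Fin.forall_fin_succ]
    · simp [Fin.forall_fin_succ]
    · simp [Fin.forall_fin_succ]
    · norm_num [Fin.forall_fin_succ, Fin.sum_univ_succ]
    · simp [Fin.forall_fin_succ, hl, e01, e12]
    · norm_num [Fin.forall_fin_succ, Fin.sum_univ_succ]
      decide
  obtain ⟨M, hM, e⟩ := exists_entries_of_mem_model (h hS)
  simp [Fin.forall_fin_succ, Fin.sum_univ_succ, hM _ _ n12, hM _ _ n02, hM _ _ n20] at e
  -- Only one direction between `0` and `1` is available; each choice gives its own inconsistent
  -- system.
  rcases n with n | n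
  · simp only [hM _ _ n] at e
    linarith
  · simp only [hM _ _ n] at e
    linarith

/-- A covariance matrix of the fork `0 ← 1 → 2` that no path with `2 → 1` explains. -/
lemma not_subset_of_fork {H₁ H₂ : Digraph (Fin 3)} (hl : ∀ v, H₁.Adj v v) (e10 : H₁.Adj 1 0)
    (e12 : H₁.Adj 1 2) (n12 : ¬ H₂.Adj 1 2) (n02 : ¬ H₂.Adj 0 2) (n20 : ¬ H₂.Adj 2 0)
    (n : ¬ H₂.Adj 0 1 ∨ ¬ H₂.Adj 1 0) :
    ¬ model H₁ ⊆ model H₂ := by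
  intro h
  have hS : !![9, 2, 4; 2, 1, 1; 4, 1, 3] ∈ model H₁ := by
    refine mem_model_of_entries !![-1, 4, 0; 0, -1, 0; 0, 2, -1]
      !![1, 0, 0; 2/9, 1, 0; 4/9, 1/5, 1] ![9, 5/9, 6/5]
      ?_ ?_ ?_ ?_ ?_ ?_
    · simp [Fin.forall_fin_succ]
    · simp [Fin.forall_fin_succ]
    · simp [Fin.forall_fin_succ]
    · norm_num [Fin.forall_fin_succ, Fin.sum_univ_succ]
    · simp [Fin.forall_fin_succ, hl, e10, e12]
    · norm_num [Fin.forall_fin_succ, Fin.sum_univ_succ]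
      decide
  obtain ⟨M, hM, e⟩ := exists_entries_of_mem_model (h hS)
  simp [Fin.forall_fin_succ, Fin.sum_univ_succ, hM _ _ n12, hM _ _ n02, hM _ _ n20] at e
  rcases n with n | n
  · simp only [hM _ _ n] at e
    linarith
  · simp only [hM _ _ n] at e
    linarith

/-- In the triangle `2 → 0 → 1 ← 2` with `2 → 3`, the edge `0 → 1` is not reversible. -/
lemma not_subset_of_triangle_source_to {H₁ H₂ : Digraph (Fin 4)} (hl : ∀ v, H₁.Adj v v)
    (e20 : H₁.Adj 2 0) (e21 : H₁.Adj 2 1) (e01 : H₁.Adj 0 1) (e23 : H₁.Adj 2 3)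
    (n01 : ¬ H₂.Adj 0 1) (n02 : ¬ H₂.Adj 0 2) (n03 : ¬ H₂.Adj 0 3) (n12 : ¬ H₂.Adj 1 2)
    (n13 : ¬ H₂.Adj 1 3) (n30 : ¬ H₂.Adj 3 0) (n31 : ¬ H₂.Adj 3 1) (n32 : ¬ H₂.Adj 3 2) :
    ¬ model H₁ ⊆ model H₂ := by
  intro h
  have hS : !![3, 1, 1, 4; 1, 2, 0, 1; 1, 0, 1, 2; 4, 1, 2, 9] ∈ model H₁ := by
    refine mem_model_of_entries !![-1, 0, 2, 0; 1, -1, -1, 0; 0, 0, -1, 0; 0, 0, 4, -1]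
      !![1, 0, 0, 0; 1/3, 1, 0, 0; 1/3, -1/5, 1, 0; 4/3, -1/5, 1, 1] ![3, 5/3, 3/5, 3]
      ?_ ?_ ?_ ?_ ?_ ?_
    · simp [Fin.forall_fin_succ]
    · simp [Fin.forall_fin_succ]
    · simp [Fin.forall_fin_succ]
    · norm_num [Fin.forall_fin_succ, Fin.sum_univ_succ]
    · simp [Fin.forall_fin_succ, hl, e20, e21, e01, e23]
    · norm_num [Fin.forall_fin_succ, Fin.sum_univ_succ]
      decide
  obtain ⟨M, hM, e⟩ := exists_entries_of_mem_model (h hS)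
  simp [Fin.forall_fin_succ, Fin.sum_univ_succ, hM _ _ n01, hM _ _ n02, hM _ _ n03, hM _ _ n12,
    hM _ _ n13, hM _ _ n30, hM _ _ n31, hM _ _ n32] at e
  linarith

/-- In the triangle `2 → 0 → 1 ← 2` with `3 → 2`, the edge `0 → 1` is not reversible. -/
lemma not_subset_of_to_triangle_source {H₁ H₂ : Digraph (Fin 4)} (hl : ∀ v, H₁.Adj v v)
    (e20 : H₁.Adj 2 0) (e21 : H₁.Adj 2 1) (e01 : H₁.Adj 0 1) (e32 : H₁.Adj 3 2)
    (n01 : ¬ H₂.Adj 0 1) (n02 : ¬ H₂.Adj 0 2) (n03 : ¬ H₂.Adj 0 3) (n12 : ¬ H₂.Adj 1 2)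
    (n13 : ¬ H₂.Adj 1 3) (n23 : ¬ H₂.Adj 2 3) (n30 : ¬ H₂.Adj 3 0) (n31 : ¬ H₂.Adj 3 1) :
    ¬ model H₁ ⊆ model H₂ := by
  intro h
  have hS : !![9, 2, 4, 1; 2, 9, 3, 1; 4, 3, 3, 1; 1, 1, 1, 1] ∈ model H₁ := by
    refine mem_model_of_entries !![-1, 0, 2, 0; -2, -1, 4, 0; 0, 0, -1, 2; 0, 0, 0, -1]
      !![1, 0, 0, 0; 2/9, 1, 0, 0; 4/9, 19/77, 1, 0; 1/9, 1/11, 14/27, 1] ![9, 77/9, 54/77, 17/27]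
      ?_ ?_ ?_ ?_ ?_ ?_
    · simp [Fin.forall_fin_succ]
    · simp [Fin.forall_fin_succ]
    · simp [Fin.forall_fin_succ]
    · norm_num [Fin.forall_fin_succ, Fin.sum_univ_succ]
    · simp [Fin.forall_fin_succ, hl, e20, e21, e01, e32]
    · norm_num [Fin.forall_fin_succ, Fin.sum_univ_succ]
      decide
  obtain ⟨M, hM, e⟩ := exists_entries_of_mem_model (h hS)
  simp [Fin.forall_fin_succ, Fin.sum_univ_succ, hM _ _ n01, hM _ _ n02, hM _ _ n03, hM _ _ n12,
    hM _ _ n13, hM _ _ n23, hM _ _ n30, hM _ _ n31] at e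
  linarith

/-- In the triangle `0 → 1 → 2 ← 0` with `2 → 3`, the edge `0 → 1` is not reversible. -/
lemma not_subset_of_triangle_sink_to {H₁ H₂ : Digraph (Fin 4)} (hl : ∀ v, H₁.Adj v v)
    (e02 : H₁.Adj 0 2) (e12 : H₁.Adj 1 2) (e01 : H₁.Adj 0 1) (e23 : H₁.Adj 2 3)
    (n01 : ¬ H₂.Adj 0 1) (n03 : ¬ H₂.Adj 0 3) (n13 : ¬ H₂.Adj 1 3) (n20 : ¬ H₂.Adj 2 0)
    (n21 : ¬ H₂.Adj 2 1) (n30 : ¬ H₂.Adj 3 0) (n31 : ¬ H₂.Adj 3 1) (n32 : ¬ H₂.Adj 3 2) :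
    ¬ model H₁ ⊆ model H₂ := by
  intro h
  have hS : !![1, 1, 0, 0; 1, 3, 2, 2; 0, 2, 5, 7; 0, 2, 7, 15] ∈ model H₁ := by
    refine mem_model_of_entries !![-1, 0, 0, 0; 2, -1, 0, 0; -2, 2, -1, 0; 0, 0, 2, -1]
      !![1, 0, 0, 0; 1, 1, 0, 0; 0, 1, 1, 0; 0, 1, 5/3, 1] ![1, 2, 3, 14/3]
      ?_ ?_ ?_ ?_ ?_ ?_
    · simp [Fin.forall_fin_succ]
    · simp [Fin.forall_fin_succ]
    · simp [Fin.forall_fin_succ]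
    · norm_num [Fin.forall_fin_succ, Fin.sum_univ_succ]
    · simp [Fin.forall_fin_succ, hl, e02, e12, e01, e23]
    · norm_num [Fin.forall_fin_succ, Fin.sum_univ_succ]
      decide
  obtain ⟨M, hM, e⟩ := exists_entries_of_mem_model (h hS)
  simp [Fin.forall_fin_succ, Fin.sum_univ_succ, hM _ _ n01, hM _ _ n03, hM _ _ n13, hM _ _ n20,
    hM _ _ n21, hM _ _ n30, hM _ _ n31, hM _ _ n32] at e
  linarith

/-- In the diamond with source `2` and sink `3`, the edge `0 → 1` is not reversible. -/
lemma not_subset_of_diamond {H₁ H₂ : Digraph (Fin 4)} (hl : ∀ v, H₁.Adj v v) (e20 : H₁.Adj 2 0)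
    (e21 : H₁.Adj 2 1) (e03 : H₁.Adj 0 3) (e13 : H₁.Adj 1 3) (e01 : H₁.Adj 0 1)
    (n01 : ¬ H₂.Adj 0 1) (n02 : ¬ H₂.Adj 0 2) (n12 : ¬ H₂.Adj 1 2) (n23 : ¬ H₂.Adj 2 3)
    (n30 : ¬ H₂.Adj 3 0) (n31 : ¬ H₂.Adj 3 1) (n32 : ¬ H₂.Adj 3 2) :
    ¬ model H₁ ⊆ model H₂ := by
  intro h
  have hS : !![3, 2, 1, 6; 2, 5, 0, 3; 1, 0, 1, 2; 6, 3, 2, 19] ∈ model H₁ := by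
    refine mem_model_of_entries !![-1, 0, 2, 0; 2, -1, -2, 0; 0, 0, -1, 0; 4, -2, 0, -1]
      !![1, 0, 0, 0; 2/3, 1, 0, 0; 1/3, -2/11, 1, 0; 2, -3/11, -1/3, 1] ![3, 11/3, 6/11, 20/3]
      ?_ ?_ ?_ ?_ ?_ ?_
    · simp [Fin.forall_fin_succ]
    · simp [Fin.forall_fin_succ]
    · simp [Fin.forall_fin_succ]
    · norm_num [Fin.forall_fin_succ, Fin.sum_univ_succ]
    · simp [Fin.forall_fin_succ, hl, e20, e21, e03, e13, e01]
    · norm_num [Fin.forall_fin_succ, Fin.sum_univ_succ]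
      decide
  obtain ⟨M, hM, e⟩ := exists_entries_of_mem_model (h hS)
  simp [Fin.forall_fin_succ, Fin.sum_univ_succ, hM _ _ n01, hM _ _ n02, hM _ _ n12, hM _ _ n23,
    hM _ _ n30, hM _ _ n31, hM _ _ n32] at e
  linarith

end Examples

end Lyapunov

namespace Lyapunov

/-! ### From local equivalence to compatibility -/

section Local

variable {V : Type*} {G₁ G₂ : Digraph V}

lemma linked_iff_of_skeleton_eq (hl₁ : ∀ v, G₁.Adj v v) (hl₂ : ∀ v, G₂.Adj v v)
    (h : skeleton G₁ = skeleton G₂) (a b : V) : Linked G₁ a b ↔ Linked G₂ a b := by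
  by_cases hab : a = b
  · subst hab
    exact iff_of_true (Or.inl (hl₁ a)) (Or.inl (hl₂ a))
  · have := congrFun (congrFun (congrArg SimpleGraph.Adj h) a) b
    simpa [skeleton, Digraph.toSimpleGraphInclusive, hab, Linked] using this

/-- `G₁` and `G₂` are acyclic graphs with the same skeleton that are model equivalent on every set
of at most four vertices. -/
structure LocallyEquiv (G₁ G₂ : Digraph V) : Prop where
  loop₁ : ∀ v, G₁.Adj v v
  loop₂ : ∀ v, G₂.Adj v v
  rank₁ : ∃ r, IsRank G₁ r
  rank₂ : ∃ r, IsRank G₂ r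
  link : ∀ a b, Linked G₁ a b ↔ Linked G₂ a b
  equiv : ∀ n ≤ 4, ∀ f : Fin n → V, Function.Injective f → ModelEquiv (pull G₁ f) (pull G₂ f)

namespace LocallyEquiv

lemma symm (h : LocallyEquiv G₁ G₂) : LocallyEquiv G₂ G₁ :=
  ⟨h.loop₂, h.loop₁, h.rank₂, h.rank₁, fun a b => (h.link a b).symm,
    fun n hn f hf => (h.equiv n hn f hf).symm⟩

/-- Otherwise `p, i, j` induce a chain or a fork in `G₁` that `G₂` would have to explain with `j →
i`. The collider at `j` is covered by exchanging the two graphs. -/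
lemma linked_of_linked (h : LocallyEquiv G₁ G₂) {i j : V} (hij : i ≠ j) (h1 : G₁.Adj i j)
    (h2 : G₂.Adj j i) {p : V} (hp : Linked G₁ p i) : Linked G₁ p j := by
  by_contra hn
  obtain ⟨r, hr⟩ := h.rank₂
  have hpi : p ≠ i := fun e => hn (e ▸ Or.inl h1)
  have hpj : p ≠ j := fun e => hn (e ▸ Or.inl (h.loop₁ p))
  have hf : Function.Injective ![p, i, j] := by
    intro a b
    fin_cases a <;> fin_cases b <;> simp [hpi, hpj, hij, hpi.symm, hpj.symm, hij.symm]
  have hn2 : ¬ Linked G₂ p j := fun e => hn ((h.link p j).2 e)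
  have n12 : ¬ G₂.Adj i j := fun e => by
    have := hr _ _ h2 hij.symm
    have := hr _ _ e hij
    omega
  have n02 : ¬ G₂.Adj p j := fun e => hn2 (Or.inl e)
  have n20 : ¬ G₂.Adj j p := fun e => hn2 (Or.inr e)
  have n : ¬ G₂.Adj p i ∨ ¬ G₂.Adj i p := by
    by_contra hc
    push Not at hc
    have := hr _ _ hc.1 hpi
    have := hr _ _ hc.2 hpi.symm
    omega
  have hsub := (h.equiv 3 (by norm_num) _ hf).le
  rcases hp with e | e
  · exact not_subset_of_chain (fun v => h.loop₁ _) e h1 n12 n02 n20 n hsub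
  · exact not_subset_of_fork (fun v => h.loop₁ _) e h1 n12 n02 n20 n hsub

lemma linked_iff_linked (h : LocallyEquiv G₁ G₂) {i j : V} (hij : i ≠ j) (h1 : G₁.Adj i j)
    (h2 : G₂.Adj j i) (p : V) : Linked G₁ p i ↔ Linked G₁ p j := by
  refine ⟨h.linked_of_linked hij h1 h2, fun hp => ?_⟩
  rw [h.link] at hp ⊢
  exact h.symm.linked_of_linked hij.symm h2 h1 hp

/-- A third vertex linked to exactly one end fixes the direction of an edge: this is the
contrapositive of `linked_iff_linked`. -/
lemma adj_of_not_linked (h : LocallyEquiv G₁ G₂) {a b c : V} (hab : G₁.Adj a b)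
    (hca : Linked G₁ c a) (hcb : ¬ Linked G₁ c b) : G₂.Adj a b :=
  ((h.link a b).1 (Or.inl hab)).resolve_right fun e =>
    hcb ((h.linked_iff_linked (fun hh : a = b => hcb (hh ▸ hca)) hab e c).1 hca)

lemma adj_of_not_linked' (h : LocallyEquiv G₁ G₂) {a b c : V} (hab : G₁.Adj a b)
    (hca : ¬ Linked G₁ c a) (hcb : Linked G₁ c b) : G₂.Adj a b :=
  ((h.link a b).1 (Or.inl hab)).resolve_right fun e =>
    hca ((h.linked_iff_linked (fun hh : a = b => hca (hh ▸ hcb)) hab e c).2 hcb)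

lemma injective_vec {a b c d : V} (hab : a ≠ b) (hac : a ≠ c) (had : a ≠ d) (hbc : b ≠ c)
    (hbd : b ≠ d) (hcd : c ≠ d) : Function.Injective ![a, b, c, d] := by
  intro x y
  fin_cases x <;> fin_cases y <;>
    simp [hab, hac, had, hbc, hbd, hcd, hab.symm, hac.symm, had.symm, hbc.symm, hbd.symm, hcd.symm]

lemma asymm {G : Digraph V} (hr : ∃ r, IsRank G r) {a b : V} (hab : a ≠ b) (h : G.Adj a b) :
    ¬ G.Adj b a := by
  obtain ⟨r, hr⟩ := hr
  exact fun e => absurd ((hr _ _ h hab).trans (hr _ _ e hab.symm)) (lt_irrefl _)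

lemma adj_trans {G : Digraph V} (hr : ∃ r, IsRank G r) {a b c : V} (hab : a ≠ b)
    (h1 : G.Adj a b) (h2 : G.Adj b c) (h3 : Linked G a c) : G.Adj a c := by
  obtain ⟨r, hr⟩ := hr
  refine h3.resolve_right fun e => ?_
  have := hr _ _ h1 hab
  have := hr.le h2
  have := hr.le e
  omega

/-- A counterexample `q` distinguishes `p` from `i` and `j`, so every edge but `i → j` keeps its
direction. This leaves a triangle with source `p` and a pendant edge at `p`, in either direction. -/
lemma linked_of_parent (h : LocallyEquiv G₁ G₂) {i j : V} (hij : i ≠ j) (h1 : G₁.Adj i j)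
    (h2 : G₂.Adj j i) {p q : V} (hp : G₁.Adj p i) (hq : Linked G₁ p q) : Linked G₁ q i := by
  by_contra hn
  have tw := h.linked_iff_linked hij h1 h2
  have hpi : p ≠ i := fun e => hn (e ▸ hq.symm)
  have hpj : p ≠ j := fun e => asymm h.rank₁ hij h1 (e ▸ hp)
  have hqi : q ≠ i := fun e => hn (e ▸ Or.inl (h.loop₁ q))
  have hqj : q ≠ j := fun e => hn (e ▸ Or.inr h1)
  have hqp : q ≠ p := fun e => hn (e ▸ Or.inl hp)
  have hnj : ¬ Linked G₁ q j := fun e => hn ((tw q).2 e)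
  have hpj1 : G₁.Adj p j := adj_trans h.rank₁ hpi hp h1 ((tw p).1 (Or.inl hp))
  have hpi2 : G₂.Adj p i := h.adj_of_not_linked hp hq.symm hn
  have hpj2 : G₂.Adj p j := h.adj_of_not_linked hpj1 hq.symm hnj
  have n1 : ¬ Linked G₂ q i := fun e => hn ((h.link _ _).2 e)
  have n2 : ¬ Linked G₂ q j := fun e => hnj ((h.link _ _).2 e)
  have hsub := (h.equiv 4 le_rfl _
    (injective_vec hij hpi.symm hqi.symm hpj.symm hqj.symm hqp.symm)).le
  have hip : Linked G₁ i p := Or.inr hp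
  have hiq : ¬ Linked G₁ i q := fun e => hn e.symm
  rcases hq with e | e
  · have e2 : G₂.Adj p q := h.adj_of_not_linked e hip hiq
    exact not_subset_of_triangle_source_to (fun v => h.loop₁ _) hp hpj1 h1 e
      (asymm h.rank₂ hij.symm h2) (asymm h.rank₂ hpi hpi2) (fun e => n1 (Or.inr e))
      (asymm h.rank₂ hpj hpj2) (fun e => n2 (Or.inr e)) (fun e => n1 (Or.inl e))
      (fun e => n2 (Or.inl e)) (asymm h.rank₂ hqp.symm e2) hsub
  · have e2 : G₂.Adj q p := h.adj_of_not_linked' e hiq hip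
    exact not_subset_of_to_triangle_source (fun v => h.loop₁ _) hp hpj1 h1 e
      (asymm h.rank₂ hij.symm h2) (asymm h.rank₂ hpi hpi2) (fun e => n1 (Or.inr e))
      (asymm h.rank₂ hpj hpj2) (fun e => n2 (Or.inr e)) (asymm h.rank₂ hqp e2)
      (fun e => n1 (Or.inl e)) (fun e => n2 (Or.inl e)) hsub

lemma linked_of_child (h : LocallyEquiv G₁ G₂) {i j : V} (hij : i ≠ j) (h1 : G₁.Adj i j)
    (h2 : G₂.Adj j i) {k l : V} (hk : G₁.Adj i k) (hl : G₁.Adj k l) : Linked G₁ l i := by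
  by_contra hn
  have tw := h.linked_iff_linked hij h1 h2
  have hnj : ¬ Linked G₁ l j := fun e => hn ((tw l).2 e)
  have hki : k ≠ i := fun e => hn (e ▸ Or.inr hl)
  have hkj : k ≠ j := fun e => hnj (e ▸ Or.inr hl)
  have hli : l ≠ i := fun e => hn (e ▸ Or.inl (h.loop₁ l))
  have hlj : l ≠ j := fun e => hn (e ▸ Or.inr h1)
  have hlk : l ≠ k := fun e => hn (e ▸ Or.inr hk)
  have hlk1 : Linked G₁ l k := Or.inr hl
  have hjk : Linked G₁ j k := ((tw k).1 (Or.inr hk)).symm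
  have hik2 : G₂.Adj i k := h.adj_of_not_linked' hk hn hlk1
  have hjk2 : G₂.Adj j k := adj_trans h.rank₂ hij.symm h2 hik2 ((h.link _ _).1 hjk)
  -- An edge `k → j` of `G₁` would persist in `G₂`, since `l` is linked to `k` but not to `j`.
  have hjk1 : G₁.Adj j k := hjk.resolve_right fun e =>
    asymm h.rank₂ hkj.symm hjk2 (h.adj_of_not_linked e hlk1 hnj)
  have hkl2 : G₂.Adj k l := h.adj_of_not_linked hl (Or.inl hk) fun e => hn e.symm
  have n1 : ¬ Linked G₂ l i := fun e => hn ((h.link _ _).2 e)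
  have n2 : ¬ Linked G₂ l j := fun e => hnj ((h.link _ _).2 e)
  exact not_subset_of_triangle_sink_to (fun v => h.loop₁ _) hk hjk1 h1 hl
    (asymm h.rank₂ hij.symm h2) (fun e => n1 (Or.inr e)) (fun e => n2 (Or.inr e))
    (asymm h.rank₂ hki.symm hik2) (asymm h.rank₂ hkj.symm hjk2) (fun e => n1 (Or.inl e))
    (fun e => n2 (Or.inl e)) (asymm h.rank₂ hlk.symm hkl2)
    (h.equiv 4 le_rfl _
      (injective_vec hij hki.symm hli.symm hkj.symm hlj.symm hlk.symm)).le

/-- If `p` and `k` are not linked, they fix all edges but `i → j`, leaving the diamond with source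
`p` and sink `k`. -/
lemma linked_parent_child (h : LocallyEquiv G₁ G₂) {i j : V} (hij : i ≠ j) (h1 : G₁.Adj i j)
    (h2 : G₂.Adj j i) {p k : V} (hp : G₁.Adj p i) (hk : G₁.Adj i k) : Linked G₁ p k := by
  by_contra hn
  have tw := h.linked_iff_linked hij h1 h2
  have hn' : ¬ Linked G₁ k p := fun e => hn e.symm
  have hpi : p ≠ i := fun e => hn (e ▸ Or.inl hk)
  have hpj : p ≠ j := fun e => asymm h.rank₁ hij h1 (e ▸ hp)
  have hki : k ≠ i := fun e => hn (e ▸ Or.inl hp)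
  have lpj : Linked G₁ p j := (tw p).1 (Or.inl hp)
  have lkj : Linked G₁ k j := (tw k).1 (Or.inr hk)
  have hkj : k ≠ j := fun e => hn (e ▸ lpj)
  have hpk : p ≠ k := fun e => hn (e ▸ Or.inl (h.loop₁ p))
  have hpi2 : G₂.Adj p i := h.adj_of_not_linked' hp hn' (Or.inr hk)
  have hik2 : G₂.Adj i k := h.adj_of_not_linked hk (Or.inl hp) hn
  have hpj1 : G₁.Adj p j := adj_trans h.rank₁ hpi hp h1 lpj
  have hpj2 : G₂.Adj p j := h.adj_of_not_linked' hpj1 hn' lkj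
  have hjk2 : G₂.Adj j k := adj_trans h.rank₂ hij.symm h2 hik2 ((h.link _ _).1 lkj.symm)
  have hjk1 : G₁.Adj j k := lkj.symm.resolve_right fun e =>
    asymm h.rank₂ hkj.symm hjk2 (h.adj_of_not_linked' e hn lpj)
  have n1 : ¬ Linked G₂ p k := fun e => hn ((h.link _ _).2 e)
  exact not_subset_of_diamond (fun v => h.loop₁ _) hp hpj1 hk hjk1 h1
    (asymm h.rank₂ hij.symm h2) (asymm h.rank₂ hpi hpi2) (asymm h.rank₂ hpj hpj2)
    (fun e => n1 (Or.inl e)) (asymm h.rank₂ hki.symm hik2) (asymm h.rank₂ hkj.symm hjk2)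
    (fun e => n1 (Or.inr e))
    (h.equiv 4 le_rfl _
      (injective_vec hij hpi.symm hki.symm hpj.symm hkj.symm hpk)).le

lemma compatible (h : LocallyEquiv G₁ G₂) : Compatible G₁ G₂ where
  link := h.link
  twin _ _ hij h1 h2 p := h.linked_iff_linked hij h1 h2 p
  parent _ _ hij h1 h2 _ _ hp hq := h.linked_of_parent hij h1 h2 hp hq
  child _ _ hij h1 h2 _ _ hk hl := h.linked_of_child hij h1 h2 hk hl
  through _ _ hij h1 h2 _ _ hp hk := h.linked_parent_child hij h1 h2 hp hk

end LocallyEquiv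

/-- Model equivalent graphs have the same edges, up to direction. -/
lemma linked_of_modelEquiv [Fintype V] [DecidableEq V] (hl₁ : ∀ v, G₁.Adj v v)
    (hl₂ : ∀ v, G₂.Adj v v) (h : ModelEquiv G₁ G₂) {a b : V} (hab : a ≠ b) (e : G₁.Adj a b) :
    Linked G₂ a b := by
  by_contra hn
  have hf : Function.Injective ![a, b] := by
    intro x y
    fin_cases x <;> fin_cases y <;> simp [hab, hab.symm]
  exact not_subset_of_edge (fun v => hl₁ _) e (fun e => hn (Or.inl e)) (fun e => hn (Or.inr e))
    (h.pull hl₁ hl₂ hf).le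

lemma skeleton_eq_of_modelEquiv [Fintype V] [DecidableEq V] (hl₁ : ∀ v, G₁.Adj v v)
    (hl₂ : ∀ v, G₂.Adj v v) (h : ModelEquiv G₁ G₂) : skeleton G₁ = skeleton G₂ := by
  ext a b
  simp only [skeleton, Digraph.toSimpleGraphInclusive, SimpleGraph.fromRel_adj]
  refine and_congr_right fun hab => ⟨fun e => e.elim ?_ ?_, fun e => e.elim ?_ ?_⟩
  · exact linked_of_modelEquiv hl₁ hl₂ h hab
  · exact fun e => (linked_of_modelEquiv hl₁ hl₂ h hab.symm e).symm
  · exact linked_of_modelEquiv hl₂ hl₁ h.symm hab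
  · exact fun e => (linked_of_modelEquiv hl₂ hl₁ h.symm hab.symm e).symm

/-- Equivalence on all four-vertex subsets gives equivalence on all smaller ones. -/
lemma modelEquiv_pull_of_induce [Fintype V] [DecidableEq V] (hV : 4 ≤ Fintype.card V)
    (hl₁ : ∀ v, G₁.Adj v v) (hl₂ : ∀ v, G₂.Adj v v)
    (h : ∀ K : Finset V, K.card = 4 → ModelEquiv (induce G₁ K) (induce G₂ K)) {n : ℕ}
    (hn : n ≤ 4) {f : Fin n → V} (hf : Function.Injective f) :
    ModelEquiv (pull G₁ f) (pull G₂ f) := by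
  -- The image of `f` is padded to exactly four vertices, which requires `4 ≤ Fintype.card V`.
  obtain ⟨K, hK, -, hc⟩ := Finset.exists_subsuperset_card_eq
    (Finset.subset_univ (Finset.univ.image f))
    (by rw [Finset.card_image_of_injective _ hf]; simpa using hn) hV
  have hmem : ∀ x, f x ∈ K := fun x => hK (Finset.mem_image_of_mem f (Finset.mem_univ x))
  have hg : Function.Injective (fun x => (⟨f x, hmem x⟩ : K)) := fun x y e =>
    hf (congrArg Subtype.val e)
  exact ModelEquiv.pull (G₁ := induce G₁ K) (G₂ := induce G₂ K) (fun v => hl₁ v)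
    (fun v => hl₂ v) hg (h K hc)

end Local

end Lyapunov

theorem mainTheorem1 {V : Type*} [Fintype V] [DecidableEq V] (hV : 4 ≤ Fintype.card V)
    (G₁ G₂ : Digraph V) (h₁ : Lyapunov.IsDAG G₁) (h₂ : Lyapunov.IsDAG G₂) :
    Lyapunov.ModelEquiv G₁ G₂ ↔
      Lyapunov.skeleton G₁ = Lyapunov.skeleton G₂ ∧
        ∀ K : Finset V, K.card = 4 →
          Lyapunov.ModelEquiv (Lyapunov.induce G₁ K) (Lyapunov.induce G₂ K) := by
  constructor
  · intro h
    exact ⟨Lyapunov.skeleton_eq_of_modelEquiv h₁.loop h₂.loop h, fun K _ =>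
      h.pull h₁.loop h₂.loop (f := fun v : K => (v : V)) Subtype.val_injective⟩
  · rintro ⟨hs, hK⟩
    have hloc : Lyapunov.LocallyEquiv G₁ G₂ :=
      { loop₁ := h₁.loop
        loop₂ := h₂.loop
        rank₁ := h₁.exists_isRank
        rank₂ := h₂.exists_isRank
        link := Lyapunov.linked_iff_of_skeleton_eq h₁.loop h₂.loop hs
        equiv := fun _ hn _ hf =>
          Lyapunov.modelEquiv_pull_of_induce hV h₁.loop h₂.loop hK hn hf }
    obtain ⟨_, hr₁⟩ := h₁.exists_isRank
    obtain ⟨_, hr₂⟩ := h₂.exists_isRank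
    exact hloc.compatible.modelEquiv h₁.loop h₂.loop hr₁ hr₂
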